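/- **Protocol.** Let $n,d\ge 1$ be integers and $f_1,\dots,f_n:\mathbb R^d\to\mathbb R$ differentiable functions. An algorithm $A$ consists of Borel maps $B_1^k,\ B_{2,i}^k:(\mathbb R^d)^{n\times k}\to\mathbb R^d$ and $L_i^k:(\mathbb R^d)^{k+1}\to\mathbb R^d$ ($k\ge 0$, $1\le i\le n$; for $k=0$ the first two are constants), where $L_i^k$ may in addition depend on the gradient oracle $\nabla f_i$. In round $k=0,1,2,\dots$ the server computes $$x^k=B_1^k(g_1^1,\dots,g_1^k,\dots,g_n^1,\dots,g_n^k),\qquad s_i^k=B_{2,i}^k(g_1^1,\dots,g_1^k,\dots,g_n^1,\dots,g_n^k),$$ and sends to each worker $i$ the vector $\bar s_i^k$ with coordinates $[\bar s_i^k]_j=[s_i^k]_j\,\eta_{i,j}^k$, where the $\eta_{i,j}^k$ are real random variables; worker $i$ then returns $g_i^{k+1}=L_i^k(\bar s_i^0,\dots,\bar s_i^k)$. **Function class.** For $\delta^0,L>0$ let $\mathcal F_{\delta^0,L}$ be the set of differentiable functions $f:\mathbb R^d\to\mathbb R$ that are bounded below and satisfy $\|\nabla f(x)-\nabla f(y)\|\le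 L\|x-y\|$ for all $x,y$ and $f(0)-\inf f\le\delta^0$. **Zero-respecting algorithms.** Write $\operatorname{supp}(x)=\{j: x_j\neq 0\}$. The algorithm $A$ is zero-respecting if for all differentiable $f_1,\dots,f_n$ with $\frac1n\sum_{i=1}^n f_i\in\mathcal F_{\delta^0,L}$, every realization of the $\eta_{i,j}^k$, every $k\ge 0$ and every $i$: 1. $\operatorname{supp}(x^k)\subseteq\bigcup_{j=1}^k\bigcup_{l=1}^n\operatorname{supp}(g_l^j)$ and $\operatorname{supp}(s_i^k)\subseteq\bigcup_{j=1}^k\bigcup_{l=1}^n\operatorname{supp}(g_l^j)$; 2. there are points $\hat g_1,\hat g_2,\dots\in\mathbb R^d$ with $\operatorname{supp}(\hat g_m)\subseteq\bigcup_{j=0}^k\operatorname{supp}(\bar s_i^j)\cup\bigcup_{l<m}\operatorname{supp}(\nabla f_i(\hat g_l))$ for all $m\ge1$, such that $\operatorname{supp}(g_i^{k+1})\subseteq\bigcup_{m\ge1}\operatorname{supp}(\hat g_m)$. **Theorem.** There are universal constants $\bar c,\hat c>0$ with the following property. Let $L,\delta^0,\varepsilon>0$ satisfy $\bar c\,\varepsilon<L\delta^0$.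 Then there is a $d_0$, depending only on $L,\delta^0,\varepsilon$, such that the following holds for all $d\ge d_0$, $n\ge2$ and $p>0$. Assume that $\mathbb P(\eta_{i,j}^k\ne0)\le p$ for all $i,j,k$, and that the families $(\eta_{i,j}^0)_{i,j},(\eta_{i,j}^1)_{i,j},\dots$ are mutually independent (the variables within one family may be dependent). Then for every zero-respecting algorithm $A$ there exist $f\in\mathcal F_{\delta^0,L}$ and differentiable $f_1,\dots,f_n:\mathbb R^d\to\mathbb R$ with $f=\frac1n\sum_{i=1}^nf_i$ such that the points $x^k$ that $A$ generates on $f_1,\dots,f_n$ satisfy $$\mathbb E\,\|\nabla f(x^k)\|^2>\varepsilon\qquad\text{for all integers } 0\le k\le\hat c\,\frac{L\delta^0}{p\,\varepsilon}.$$ -/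

import Mathlib

open MeasureTheory ProbabilityTheory

namespace LowerBound

/-- The space `ℝ^d` with its Euclidean norm. -/
abbrev Vec (d : ℕ) : Type := EuclideanSpace ℝ (Fin d)

/-- The support `{c | x_c ≠ 0}` of a vector. -/
def supp {d : ℕ} (x : Vec d) : Set (Fin d) := {c | x c ≠ 0}

/-- The class of differentiable `L`-smooth functions `f : ℝ^d → ℝ`, bounded below, with
`f(0) - inf f ≤ δ`. -/
def FunctionClass (d : ℕ) (δ L : ℝ) : Set (Vec d → ℝ) :=
  {f | Differentiable ℝ f ∧
    (∀ x y : Vec d, ‖gradient f x - gradient f y‖ ≤ L * ‖x - y‖) ∧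
    BddBelow (Set.range f) ∧ f 0 - ⨅ x : Vec d, f x ≤ δ}

/-- The average `(1/n) ∑ i, f_i`. -/
noncomputable def average {n d : ℕ} (fs : Fin n → Vec d → ℝ) : Vec d → ℝ :=
  fun x => (1 / (n : ℝ)) * ∑ i : Fin n, fs i x

/-- The admissible inputs of the protocol: differentiable functions `f_1, …, f_n` on `ℝ^d` whose
average lies in `FunctionClass d δ L`. -/
def ProblemClass (n d : ℕ) (δ L : ℝ) : Set (Fin n → Vec d → ℝ) :=
  {fs | (∀ i, Differentiable ℝ (fs i)) ∧ average fs ∈ FunctionClass d δ L}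

/-- The mappings that make up an algorithm with `n` workers in dimension `d`. A history of `k`
rounds of worker messages is a function `Fin k → Fin n → ℝ^d`, whose entry with index `j` holds the
messages `g_1^{j+1}, …, g_n^{j+1}` produced in round `j`. The local mapping of a worker gets the
gradient oracle of its own function and all vectors that it has received in rounds `0, …, k`. -/
structure Algorithm (n d : ℕ) where
  /-- `B_1^k`: the server computes a new point. -/
  point : (k : ℕ) → (Fin k → Fin n → Vec d) → Vec d
  /-- `B_{2,i}^k`: the server computes the vector to be sent to worker `i`. -/
  aggregate : (k : ℕ) → Fin n → (Fin k → Fin n → Vec d) → Vec d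
  /-- `L_i^k`: worker `i` computes its message. -/
  worker : (k : ℕ) → Fin n → (Vec d → Vec d) → (Fin (k + 1) → Vec d) → Vec d

/-- Coordinatewise product of the vector `s` with the multipliers `h`. -/
noncomputable def sparsify {d : ℕ} (h : Fin d → ℝ) (s : Vec d) : Vec d :=
  WithLp.toLp 2 (fun c => s c * h c)

namespace Algorithm

variable {n d : ℕ}

/-- The message `g_i^{k+1}` that worker `i` sends in round `k`, when the protocol is run on
`f_1, …, f_n` and the server-to-worker multipliers are `h`. -/
noncomputable def workerMessage (A : Algorithm n d) (fs : Fin n → Vec d → ℝ)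
    (h : ℕ → Fin n → Fin d → ℝ) (k : ℕ) (i : Fin n) : Vec d :=
  A.worker k i (gradient (fs i)) (fun j : Fin (k + 1) =>
    sparsify (h j i) (A.aggregate j i (fun l : Fin (j : ℕ) => fun i' : Fin n =>
      workerMessage A fs h l i')))
termination_by k
decreasing_by
  have h₁ := j.2
  have h₂ := l.2
  omega

/-- The point `x^k` of round `k`. -/
noncomputable def iterate (A : Algorithm n d) (fs : Fin n → Vec d → ℝ)
    (h : ℕ → Fin n → Fin d → ℝ) (k : ℕ) : Vec d :=
  A.point k (fun l : Fin k => fun i : Fin n => A.workerMessage fs h l i)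

/-- The vector `s_i^k` that the server computes for worker `i` in round `k`. -/
noncomputable def serverMessage (A : Algorithm n d) (fs : Fin n → Vec d → ℝ)
    (h : ℕ → Fin n → Fin d → ℝ) (k : ℕ) (i : Fin n) : Vec d :=
  A.aggregate k i (fun l : Fin k => fun i' : Fin n => A.workerMessage fs h l i')

/-- The sparsified vector that worker `i` receives in round `k`. -/
noncomputable def received (A : Algorithm n d) (fs : Fin n → Vec d → ℝ)
    (h : ℕ → Fin n → Fin d → ℝ) (k : ℕ) (i : Fin n) : Vec d :=
  sparsify (h k i) (A.serverMessage fs h k i)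

theorem workerMessage_eq (A : Algorithm n d) (fs : Fin n → Vec d → ℝ)
    (h : ℕ → Fin n → Fin d → ℝ) (k : ℕ) (i : Fin n) :
    A.workerMessage fs h k i =
      A.worker k i (gradient (fs i)) (fun j : Fin (k + 1) => A.received fs h j i) := by
  rw [workerMessage]
  rfl

/-- The union of the supports of all worker messages sent before round `k`. -/
def knownToServer (A : Algorithm n d) (fs : Fin n → Vec d → ℝ)
    (h : ℕ → Fin n → Fin d → ℝ) (k : ℕ) : Set (Fin d) :=
  ⋃ j : Fin k, ⋃ i : Fin n, supp (A.workerMessage fs h j i)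

/-- The union of the supports of all vectors received by worker `i` up to round `k`. -/
def knownToWorker (A : Algorithm n d) (fs : Fin n → Vec d → ℝ)
    (h : ℕ → Fin n → Fin d → ℝ) (k : ℕ) (i : Fin n) : Set (Fin d) :=
  ⋃ j : Fin (k + 1), supp (A.received fs h j i)

/-- The run of `A` on `f_1, …, f_n` with multipliers `h` is zero-respecting. In every round each
worker may make any number of local gradient calls, at points `q 0, q 1, …`. -/
def RespectsZeros (A : Algorithm n d) (fs : Fin n → Vec d → ℝ)
    (h : ℕ → Fin n → Fin d → ℝ) : Prop :=
  ∀ k : ℕ,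
    supp (A.iterate fs h k) ⊆ A.knownToServer fs h k ∧
    ∀ i : Fin n,
      supp (A.serverMessage fs h k i) ⊆ A.knownToServer fs h k ∧
      ∃ q : ℕ → Vec d,
        (∀ m : ℕ, supp (q m) ⊆
          A.knownToWorker fs h k i ∪ ⋃ l : Fin m, supp (gradient (fs i) (q l))) ∧
        supp (A.workerMessage fs h k i) ⊆ ⋃ m : ℕ, supp (q m)

/-- All mappings of the algorithm are Borel measurable functions of the exchanged vectors, for all
inputs in the class `P`. -/
def IsBorel (A : Algorithm n d) (P : Set (Fin n → Vec d → ℝ)) : Prop :=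
  (∀ k, Measurable (A.point k)) ∧
  (∀ k i, Measurable (A.aggregate k i)) ∧
  (∀ fs ∈ P, ∀ k i, Measurable (A.worker k i (gradient (fs i))))

/-- `A` is a zero-respecting algorithm for the class `P` of inputs, in the protocol with random
multipliers `η`. -/
def IsZeroRespecting {Ω : Type*} (A : Algorithm n d) (P : Set (Fin n → Vec d → ℝ))
    (η : ℕ → Ω → Fin n → Fin d → ℝ) : Prop :=
  A.IsBorel P ∧ ∀ fs ∈ P, ∀ ω : Ω, A.RespectsZeros fs (fun k => η k ω)

end Algorithm

end LowerBound

/-!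
The hard function is a chain `f (x) = a * ∑_{m < T} link (c_m, c_{m+1})`, where `c_1, c_2, …` are the
rescaled coordinates of `x` and `c_0 = 1`. A link exerts no force while `c_m = c_{m+1} = 0`, and
pushes `c_{m+1}` upwards once `c_m ≥ 1`, so that the gradient of `f` stays large at every point whose
`T`-th coordinate is zero (`one_div_twenty_le_norm_chainGrad`): at the first coordinate below `1`
all contributions to the partial derivative point the same way, up to a dominated barrier term.
The links are built from `arctan`, hence the gradient is bounded, and Lipschitz with a constant that
does not depend on `T`, while `f 0 - inf f` grows linearly in `T`; after rescaling, the class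
`FunctionClass d δ L` leaves room for `T` of order `L δ / ε`.

Worker `0` gets the links that start at even coordinates and worker `1` those that start at odd
ones. The owner of the link from `N` to `N + 1` cannot discover coordinate `N` by itself: it must
receive it from the server, through one particular multiplier, which is nonzero with probability at
most `p`. Therefore the number of discovered coordinates is dominated, along every run, by the
process `frontier` (`frontier_spec`), which is a function of the multipliers alone. Its
position before round `k` is independent of the multipliers of round `k`, so its expectation grows
by at most `p` in a round (`integral_frontier_le`), and Markov's inequality shows that it stays below
`T` with probability at least `1 / 2` for all `k` up to order `T / p`. On that event the `T`-th
coordinate of `x^k` vanishes. Boundedness of the gradient of `f` makes the expectation a genuine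
integral whatever the moments of `x^k` are.
-/

namespace LowerBound

/-! ### Bounded Lipschitz functions -/

/-- Real functions on a metric space that are both bounded and Lipschitz. They form an algebra. -/
def BoundedLipschitz {X : Type*} [PseudoMetricSpace X] (f : X → ℝ) : Prop :=
  ∃ K : ℝ, 0 ≤ K ∧ (∀ x, |f x| ≤ K) ∧ ∀ x y, |f x - f y| ≤ K * dist x y

namespace BoundedLipschitz

variable {X Y : Type*} [PseudoMetricSpace X] [PseudoMetricSpace Y] {f g : X → ℝ}

theorem const (c : ℝ) : BoundedLipschitz (fun _ : X => c) :=
  ⟨|c|, abs_nonneg c, fun _ => le_rfl, fun x y => by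
    rw [sub_self, abs_zero]; positivity⟩

theorem add (hf : BoundedLipschitz f) (hg : BoundedLipschitz g) :
    BoundedLipschitz (fun x => f x + g x) := by
  obtain ⟨K, hK, hf, hf'⟩ := hf
  obtain ⟨M, hM, hg, hg'⟩ := hg
  refine ⟨K + M, by positivity, fun x => (abs_add_le _ _).trans (add_le_add (hf x) (hg x)),
    fun x y => ?_⟩
  rw [add_sub_add_comm, add_mul]
  exact (abs_add_le _ _).trans (add_le_add (hf' x y) (hg' x y))

theorem mul (hf : BoundedLipschitz f) (hg : BoundedLipschitz g) :
    BoundedLipschitz (fun x => f x * g x) := by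
  obtain ⟨K, hK, hf, hf'⟩ := hf
  obtain ⟨M, hM, hg, hg'⟩ := hg
  refine ⟨2 * (K * M), by positivity, fun x => ?_, fun x y => ?_⟩
  · rw [abs_mul]
    have := mul_le_mul (hf x) (hg x) (abs_nonneg _) hK
    nlinarith [mul_nonneg hK hM]
  · have h : f x * g x - f y * g y = f x * (g x - g y) + (f x - f y) * g y := by ring
    rw [h]
    refine (abs_add_le _ _).trans ?_
    rw [abs_mul, abs_mul]
    have h₁ := mul_le_mul (hf x) (hg' x y) (abs_nonneg _) hK
    have h₂ := mul_le_mul (hf' x y) (hg y) (abs_nonneg _) (by positivity)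
    linarith

theorem neg (hf : BoundedLipschitz f) : BoundedLipschitz (fun x => -f x) := by
  simpa using (const (-1)).mul hf

theorem comp (hf : BoundedLipschitz f) {u : Y → X} (hu : LipschitzWith 1 u) :
    BoundedLipschitz (fun y => f (u y)) := by
  obtain ⟨K, hK, hf, hf'⟩ := hf
  refine ⟨K, hK, fun y => hf _, fun x y => (hf' _ _).trans ?_⟩
  have := hu.dist_le_mul x y
  rw [NNReal.coe_one, one_mul] at this
  gcongr

end BoundedLipschitz

/-! ### The scalar building blocks -/

theorem lipschitzWith_arctan : LipschitzWith 1 Real.arctan := by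
  refine lipschitzWith_of_nnnorm_deriv_le Real.differentiable_arctan fun x => ?_
  rw [← NNReal.coe_le_coe, coe_nnnorm, NNReal.coe_one, Real.deriv_arctan, Real.norm_eq_abs,
    abs_of_nonneg (by positivity), div_le_one (by positivity)]
  nlinarith [sq_nonneg x]

theorem boundedLipschitz_arctan : BoundedLipschitz Real.arctan := by
  refine ⟨2, by norm_num, fun x => ?_, fun x y => ?_⟩
  · rw [abs_le]
    constructor <;>
      linarith [Real.arctan_lt_pi_div_two x, Real.neg_pi_div_two_lt_arctan x, Real.pi_le_four]
  · have := lipschitzWith_arctan.dist_le_mul x y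
    rw [NNReal.coe_one, one_mul, Real.dist_eq] at this
    linarith [dist_nonneg (x := x) (y := y)]

theorem boundedLipschitz_sin_arctan : BoundedLipschitz (fun t => Real.sin (Real.arctan t)) := by
  refine BoundedLipschitz.comp (f := Real.sin) ⟨1, by norm_num, Real.abs_sin_le_one, fun x y => ?_⟩
    lipschitzWith_arctan
  rw [one_mul, ← Real.dist_eq]
  simpa using Real.lipschitzWith_sin.dist_le_mul x y

theorem boundedLipschitz_cos_arctan : BoundedLipschitz (fun t => Real.cos (Real.arctan t)) := by
  refine BoundedLipschitz.comp (f := Real.cos) ⟨1, by norm_num, Real.abs_cos_le_one, fun x y => ?_⟩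
    lipschitzWith_arctan
  rw [one_mul, ← Real.dist_eq]
  simpa using Real.lipschitzWith_cos.dist_le_mul x y

/-- The energy of one link of the chain, as a function of the value `s` of a coordinate and the
value `t` of the next one. The factor `arctan s ^ 3` vanishes at `0` together with its derivative,
so the first summand exerts no force on `t` until `s` is nonzero; the last summand keeps `t` from
escaping to `-∞`, where the force of the first one fades. -/
noncomputable def link (s t : ℝ) : ℝ :=
  -(Real.arctan s ^ 3 * (Real.arctan t + Real.pi / 2)) + √(1 + t ^ 2) / 10

/-- The partial derivative of `link` in its first argument, see `hasFDerivAt_link_comp`. -/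
noncomputable def linkFst (s t : ℝ) : ℝ :=
  -(3 * Real.arctan s ^ 2 * Real.cos (Real.arctan s) ^ 2 * (Real.arctan t + Real.pi / 2))

/-- The partial derivative of `link` in its second argument, see `hasFDerivAt_link_comp`. -/
noncomputable def linkSnd (s t : ℝ) : ℝ :=
  -(Real.arctan s ^ 3 * Real.cos (Real.arctan t) ^ 2) + Real.sin (Real.arctan t) / 10

theorem hasDerivAt_arctan_cos (t : ℝ) :
    HasDerivAt Real.arctan (Real.cos (Real.arctan t) ^ 2) t := by
  rw [Real.cos_sq_arctan]
  exact Real.hasDerivAt_arctan t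

theorem hasDerivAt_sqrt_one_add_sq (t : ℝ) :
    HasDerivAt (fun u : ℝ => √(1 + u ^ 2)) (Real.sin (Real.arctan t)) t := by
  have h := ((hasDerivAt_pow 2 t).const_add 1).sqrt (by positivity)
  convert h using 1
  rw [Real.sin_arctan]
  field_simp
  norm_num
  ring

theorem hasFDerivAt_link_comp {E : Type*} [NormedAddCommGroup E] [NormedSpace ℝ E]
    {u v : E → ℝ} {u' v' : E →L[ℝ] ℝ} {x : E} (hu : HasFDerivAt u u' x)
    (hv : HasFDerivAt v v' x) :
    HasFDerivAt (fun y => link (u y) (v y))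
      (linkFst (u x) (v x) • u' + linkSnd (u x) (v x) • v') x := by
  have h₁ := ((hasDerivAt_arctan_cos (u x)).pow 3).comp_hasFDerivAt x hu
  have h₂ := ((hasDerivAt_arctan_cos (v x)).add_const (Real.pi / 2)).comp_hasFDerivAt x hv
  have h₃ := ((hasDerivAt_sqrt_one_add_sq (v x)).div_const 10).comp_hasFDerivAt x hv
  refine (((h₁.mul h₂).neg).add h₃).congr_fderiv ?_
  ext y
  simp [linkFst, linkSnd]
  ring

theorem linkFst_zero_left (t : ℝ) : linkFst 0 t = 0 := by
  simp [linkFst]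

theorem linkSnd_zero_zero : linkSnd 0 0 = 0 := by
  simp [linkSnd]

theorem linkFst_nonpos (s t : ℝ) : linkFst s t ≤ 0 := by
  have := Real.neg_pi_div_two_lt_arctan t
  rw [linkFst, neg_nonpos]
  exact mul_nonneg (by positivity) (by linarith)

/-- As long as `s` has reached `1` and `t` has not, the link pushes `t` upwards. -/
theorem linkSnd_le {s t : ℝ} (hs : 1 ≤ s) (ht : t ≤ 1) : linkSnd s t ≤ -(1 / 20) := by
  have hpi := Real.pi_gt_three
  have hs' : Real.pi / 4 ≤ Real.arctan s := by
    rw [← Real.arctan_one]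
    exact Real.arctan_mono hs
  have hcube : (1 : ℝ) / 3 ≤ Real.arctan s ^ 3 := by
    have := pow_le_pow_left₀ (by norm_num : (0 : ℝ) ≤ 3 / 4) (by linarith : 3 / 4 ≤ Real.arctan s) 3
    norm_num at this
    linarith
  rw [linkSnd]
  rcases le_or_gt (-1) t with h | h
  · have hcos : 1 / 2 ≤ Real.cos (Real.arctan t) ^ 2 := by
      rw [Real.cos_sq_arctan]
      have : t ^ 2 ≤ 1 := by nlinarith
      gcongr
      linarith
    have := mul_le_mul hcube hcos (by norm_num) (by positivity)
    linarith [Real.sin_le_one (Real.arctan t)]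
  · have hsin : Real.sin (Real.arctan t) ≤ -(1 / 2) := by
      rw [Real.sin_arctan, div_le_iff₀ (by positivity)]
      have : √(1 + t ^ 2) ≤ -(2 * t) := by
        rw [Real.sqrt_le_left (by linarith)]
        nlinarith
      linarith
    have : 0 ≤ Real.arctan s ^ 3 * Real.cos (Real.arctan t) ^ 2 := by positivity
    linarith

/-- A single constant controls the size of the link energy and of its gradient, and the Lipschitz
constant of the gradient. -/
theorem exists_link_bounds : ∃ K : ℝ, 0 < K ∧
    (∀ s t, -K ≤ link s t) ∧
    (∀ s t, |linkFst s t| ≤ K) ∧ (∀ s t, |linkSnd s t| ≤ K) ∧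
    (∀ s t s' t', (linkFst s t - linkFst s' t') ^ 2 ≤ K ^ 2 * ((s - s') ^ 2 + (t - t') ^ 2)) ∧
    (∀ s t s' t', (linkSnd s t - linkSnd s' t') ^ 2 ≤ K ^ 2 * ((s - s') ^ 2 + (t - t') ^ 2)) := by
  have as := boundedLipschitz_arctan.comp (LipschitzWith.prod_fst (α := ℝ) (β := ℝ))
  have at' := boundedLipschitz_arctan.comp (LipschitzWith.prod_snd (α := ℝ) (β := ℝ))
  have cs := boundedLipschitz_cos_arctan.comp (LipschitzWith.prod_fst (α := ℝ) (β := ℝ))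
  have ct := boundedLipschitz_cos_arctan.comp (LipschitzWith.prod_snd (α := ℝ) (β := ℝ))
  have st := boundedLipschitz_sin_arctan.comp (LipschitzWith.prod_snd (α := ℝ) (β := ℝ))
  have hΦ := at'.add (.const (Real.pi / 2))
  have h₀ : BoundedLipschitz (fun z : ℝ × ℝ =>
      -(Real.arctan z.1 ^ 3 * (Real.arctan z.2 + Real.pi / 2))) := by
    simpa only [pow_succ, pow_zero, one_mul] using ((as.mul as).mul as |>.mul hΦ).neg
  have h₁ : BoundedLipschitz (fun z : ℝ × ℝ => linkFst z.1 z.2) := by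
    simpa only [linkFst, pow_succ, pow_zero, one_mul] using
      ((((BoundedLipschitz.const 3).mul (as.mul as)).mul (cs.mul cs)).mul hΦ).neg
  have h₂ : BoundedLipschitz (fun z : ℝ × ℝ => linkSnd z.1 z.2) := by
    simpa only [linkSnd, pow_succ, pow_zero, one_mul, div_eq_mul_inv] using
      ((as.mul as).mul as |>.mul (ct.mul ct)).neg.add (st.mul (.const 10⁻¹))
  obtain ⟨K₀, hK₀, b₀, -⟩ := h₀
  obtain ⟨K₁, hK₁, b₁, l₁⟩ := h₁
  obtain ⟨K₂, hK₂, b₂, l₂⟩ := h₂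
  have key : ∀ C s t s' t' u : ℝ, 0 ≤ C → C ≤ K₀ + K₁ + K₂ + 1 →
      |u| ≤ C * dist (s, t) (s', t') →
      u ^ 2 ≤ (K₀ + K₁ + K₂ + 1) ^ 2 * ((s - s') ^ 2 + (t - t') ^ 2) := by
    intro C s t s' t' u hC hCK hu
    have hd : dist (s, t) (s', t') ^ 2 ≤ (s - s') ^ 2 + (t - t') ^ 2 := by
      rw [Prod.dist_eq]
      simp only [Real.dist_eq]
      rcases max_choice |s - s'| |t - t'| with h | h <;> rw [h, sq_abs] <;>
        nlinarith [sq_nonneg (s - s'), sq_nonneg (t - t')]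
    calc u ^ 2 = |u| ^ 2 := (sq_abs u).symm
      _ ≤ (C * dist (s, t) (s', t')) ^ 2 := by gcongr
      _ = C ^ 2 * dist (s, t) (s', t') ^ 2 := by ring
      _ ≤ _ := by gcongr
  refine ⟨K₀ + K₁ + K₂ + 1, by positivity, fun s t => ?_, fun s t => ?_, fun s t => ?_,
    fun s t s' t' => ?_, fun s t s' t' => ?_⟩
  · have := (abs_le.1 (b₀ (s, t))).1
    have h : 0 ≤ √(1 + t ^ 2) / 10 := by positivity
    simp only at this
    rw [link]
    linarith
  · have := b₁ (s, t)
    simp only at this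
    linarith
  · have := b₂ (s, t)
    simp only at this
    linarith
  · exact key K₁ _ _ _ _ _ hK₁ (by linarith) (l₁ (s, t) (s', t'))
  · exact key K₂ _ _ _ _ _ hK₂ (by linarith) (l₂ (s, t) (s', t'))

/-! ### Orthogonal families of vectors of norm at most one -/

section Orthogonal

variable {E ι : Type*} [NormedAddCommGroup E] [InnerProductSpace ℝ E] {v : ι → E}

theorem norm_sum_smul_sq_le (hv : Pairwise fun a b => inner ℝ (v a) (v b) = 0)
    (hv' : ∀ a, ‖v a‖ ≤ 1) (c : ι → ℝ) (S : Finset ι) :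
    ‖∑ a ∈ S, c a • v a‖ ^ 2 ≤ ∑ a ∈ S, c a ^ 2 := by
  classical
  induction S using Finset.induction_on with
  | empty => simp
  | insert a S ha ih =>
    have h₀ : inner ℝ (c a • v a) (∑ b ∈ S, c b • v b) = 0 := by
      rw [inner_sum]
      refine Finset.sum_eq_zero fun b hb => ?_
      have hab : a ≠ b := fun h => ha (h ▸ hb)
      rw [real_inner_smul_left, real_inner_smul_right, hv hab, mul_zero, mul_zero]
    have h₁ : ‖c a • v a‖ ^ 2 ≤ c a ^ 2 := by
      rw [norm_smul, mul_pow, Real.norm_eq_abs, sq_abs]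
      exact mul_le_of_le_one_right (sq_nonneg _) (pow_le_one₀ (norm_nonneg _) (hv' a))
    rw [Finset.sum_insert ha, Finset.sum_insert ha, norm_add_sq_real, h₀]
    linarith

theorem sum_inner_sq_le_norm_sq (hv : Pairwise fun a b => inner ℝ (v a) (v b) = 0)
    (hv' : ∀ a, ‖v a‖ ≤ 1) (S : Finset ι) (x : E) :
    ∑ a ∈ S, inner ℝ (v a) x ^ 2 ≤ ‖x‖ ^ 2 := by
  have h₁ := norm_sum_smul_sq_le hv hv' (fun a => inner ℝ (v a) x) S
  have h₂ : inner ℝ (∑ a ∈ S, inner ℝ (v a) x • v a) x = ∑ a ∈ S, inner ℝ (v a) x ^ 2 := by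
    rw [sum_inner]
    exact Finset.sum_congr rfl fun a _ => by rw [real_inner_smul_left, sq]
  have h₃ := norm_sub_sq_real (∑ a ∈ S, inner ℝ (v a) x • v a) x
  rw [h₂] at h₃
  linarith [sq_nonneg ‖∑ a ∈ S, inner ℝ (v a) x • v a - x‖]

end Orthogonal

/-! ### The chain function -/

variable {d : ℕ}

/-- The standard basis vectors of `ℝ^d`, numbered from `1` and extended by zero: `unitVec 0 = 0`,
and `unitVec (i + 1)` is the basis vector with index `i` if `i < d` and `0` otherwise. -/
noncomputable def unitVec (d m : ℕ) : Vec d :=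
  WithLp.toLp 2 fun i => if (i : ℕ) + 1 = m then 1 else 0

@[simp]
theorem unitVec_apply (m : ℕ) (i : Fin d) :
    unitVec d m i = if (i : ℕ) + 1 = m then 1 else 0 := rfl

/-- The coordinates of `x`, numbered from `1`, with the constant `1` as coordinate `0`. -/
noncomputable def coord (m : ℕ) (x : Vec d) : ℝ :=
  (if m = 0 then 1 else 0) + inner ℝ (unitVec d m) x

theorem inner_unitVec_succ (i : Fin d) (x : Vec d) : inner ℝ (unitVec d (i + 1)) x = x i := by
  rw [PiLp.inner_apply, Finset.sum_eq_single i]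
  · simp
  · intro b _ hb
    simp [Fin.val_inj, hb]
  · simp

theorem coord_succ (i : Fin d) (x : Vec d) : coord (i + 1) x = x i := by
  rw [coord, inner_unitVec_succ, if_neg (Nat.succ_ne_zero _), zero_add]

theorem unitVec_zero : unitVec d 0 = 0 := by
  ext i
  simp

theorem unitVec_of_lt {m : ℕ} (h : d < m) : unitVec d m = 0 := by
  ext i
  have : (i : ℕ) + 1 ≠ m := by omega
  simp [this]

theorem coord_zero (x : Vec d) : coord 0 x = 1 := by
  simp [coord, unitVec_zero]

theorem coord_sub (m : ℕ) (x y : Vec d) :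
    coord m x - coord m y = inner ℝ (unitVec d m) (x - y) := by
  rw [coord, coord, inner_sub_right]
  ring

theorem pairwise_inner_unitVec :
    Pairwise fun a b : ℕ => inner ℝ (unitVec d a) (unitVec d b) = 0 := by
  intro a b hab
  rw [PiLp.inner_apply]
  refine Finset.sum_eq_zero fun i _ => ?_
  by_cases h : (i : ℕ) + 1 = a
  · have : (i : ℕ) + 1 ≠ b := fun h' => hab (h.symm.trans h')
    simp [this]
  · simp [h]

theorem norm_unitVec_le (m : ℕ) : ‖unitVec d m‖ ≤ 1 := by
  rcases m with _ | m
  · simp [unitVec_zero]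
  · rcases lt_or_ge m d with h | h
    · have h₁ := inner_unitVec_succ ⟨m, h⟩ (unitVec d (m + 1))
      simp only [real_inner_self_eq_norm_sq, unitVec_apply, if_true] at h₁
      nlinarith [norm_nonneg (unitVec d (m + 1))]
    · rw [unitVec_of_lt (by omega), norm_zero]
      exact zero_le_one

theorem hasFDerivAt_coord (m : ℕ) (x : Vec d) :
    HasFDerivAt (coord m) (innerSL ℝ (unitVec d m)) x :=
  (innerSL ℝ (unitVec d m)).hasFDerivAt.const_add _

/-- The sum of the links between the coordinates `m` and `m + 1` over `m ∈ S`. For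
`S = {0, …, T - 1}` this is the hard function. -/
noncomputable def chain (S : Finset ℕ) (x : Vec d) : ℝ :=
  ∑ m ∈ S, link (coord m x) (coord (m + 1) x)

/-- The gradient of `chain S`, see `hasGradientAt_chain`. -/
noncomputable def chainGrad (S : Finset ℕ) (x : Vec d) : Vec d :=
  ∑ m ∈ S, (linkFst (coord m x) (coord (m + 1) x) • unitVec d m +
    linkSnd (coord m x) (coord (m + 1) x) • unitVec d (m + 1))

theorem hasGradientAt_chain (S : Finset ℕ) (x : Vec d) :
    HasGradientAt (chain S) (chainGrad S x) x := by
  rw [hasGradientAt_iff_hasFDerivAt]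
  refine (HasFDerivAt.fun_sum fun m (_ : m ∈ S) =>
    hasFDerivAt_link_comp (hasFDerivAt_coord m x) (hasFDerivAt_coord (m + 1) x)).congr_fderiv ?_
  ext y
  simp [chainGrad]

theorem chainGrad_apply (S : Finset ℕ) (x : Vec d) (i : Fin d) :
    chainGrad S x i =
      (if (i : ℕ) + 1 ∈ S then linkFst (coord (i + 1) x) (coord (i + 2) x) else 0) +
      (if (i : ℕ) ∈ S then linkSnd (coord i x) (coord (i + 1) x) else 0) := by
  rw [chainGrad, Finset.sum_add_distrib]
  simp [Finset.sum_apply]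

/-- The zero-chain property: the part of the chain without the link from coordinate `M` to
coordinate `M + 1` does not lead out of the first `M` coordinates. -/
theorem supp_chainGrad_subset {S : Finset ℕ} {M : ℕ} (hM : M ∉ S) {x : Vec d}
    (hx : supp x ⊆ {i | (i : ℕ) < M}) : supp (chainGrad S x) ⊆ {i | (i : ℕ) < M} := by
  intro i hi
  by_contra hiM
  have hiM : M ≤ (i : ℕ) := not_lt.1 hiM
  have hzero : ∀ j : Fin d, M ≤ (j : ℕ) → coord (j + 1) x = 0 := by
    intro j hj
    rw [coord_succ]
    by_contra h
    exact absurd (hx h) (not_lt.2 hj)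
  apply hi
  rw [chainGrad_apply, hzero i hiM, linkFst_zero_left, ite_self, zero_add]
  by_cases hS : (i : ℕ) ∈ S
  · have hne : M ≠ (i : ℕ) := fun h => hM (h ▸ hS)
    have := hzero ⟨(i : ℕ) - 1, by omega⟩ (show M ≤ (i : ℕ) - 1 by omega)
    have h' : (i : ℕ) - 1 + 1 = i := by omega
    simp only [h'] at this
    rw [if_pos hS, this, linkSnd_zero_zero]
  · rw [if_neg hS]

/-- Before the last coordinate of the chain has become nonzero the gradient is large: at the first
coordinate below `1` the partial derivative is negative and bounded away from zero, because the two
links that meet there contribute with the same sign. -/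
theorem one_div_twenty_le_norm_chainGrad {T : ℕ} (hTd : T ≤ d) {x : Vec d}
    (hx : ∃ i : Fin d, (i : ℕ) < T ∧ x i < 1) :
    1 / 20 ≤ ‖chainGrad (Finset.range T) x‖ := by
  classical
  have hex : ∃ m, coord (m + 1) x < 1 ∧ m < T := by
    obtain ⟨i, hi, hxi⟩ := hx
    exact ⟨i, by rwa [coord_succ], hi⟩
  obtain ⟨hm, hmT⟩ := Nat.find_spec hex
  set m := Nat.find hex with hmdef
  have hprev : 1 ≤ coord m x := by
    rcases Nat.eq_zero_or_pos m with h | h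
    · rw [h, coord_zero]
    · have := Nat.find_min hex (show m - 1 < m by omega)
      rw [show m - 1 + 1 = m by omega] at this
      by_contra hlt
      exact this ⟨not_le.1 hlt, by omega⟩
  have h₁ := chainGrad_apply (Finset.range T) x ⟨m, by omega⟩
  simp only [Finset.mem_range, if_pos hmT] at h₁
  have h₂ := linkSnd_le hprev hm.le
  have h₃ : (if m + 1 < T then linkFst (coord (m + 1) x) (coord (m + 2) x) else 0) ≤ 0 := by
    split_ifs
    · exact linkFst_nonpos _ _
    · exact le_rfl
  have h₄ := PiLp.norm_apply_le (chainGrad (Finset.range T) x) ⟨m, by omega⟩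
  rw [Real.norm_eq_abs] at h₄
  have := neg_abs_le (chainGrad (Finset.range T) x ⟨m, by omega⟩)
  linarith

theorem norm_chainGrad_le {K : ℝ} (h₁ : ∀ s t, |linkFst s t| ≤ K) (h₂ : ∀ s t, |linkSnd s t| ≤ K)
    (S : Finset ℕ) (x : Vec d) : ‖chainGrad S x‖ ≤ S.card * (2 * K) := by
  rw [← nsmul_eq_mul]
  refine (norm_sum_le _ _).trans (Finset.sum_le_card_nsmul _ _ _ fun m _ => ?_)
  have h : ∀ (c : ℝ) (k : ℕ), |c| ≤ K → ‖c • unitVec d k‖ ≤ K := by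
    intro c k hc
    rw [norm_smul, Real.norm_eq_abs]
    exact (mul_le_of_le_one_right (abs_nonneg _) (norm_unitVec_le k)).trans hc
  rw [two_mul]
  exact (norm_add_le _ _).trans (add_le_add (h _ _ (h₁ _ _)) (h _ _ (h₂ _ _)))

theorem norm_chainGrad_sub_le {K : ℝ} (hK : 0 ≤ K)
    (h₁ : ∀ s t s' t', (linkFst s t - linkFst s' t') ^ 2 ≤ K ^ 2 * ((s - s') ^ 2 + (t - t') ^ 2))
    (h₂ : ∀ s t s' t', (linkSnd s t - linkSnd s' t') ^ 2 ≤ K ^ 2 * ((s - s') ^ 2 + (t - t') ^ 2))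
    (S : Finset ℕ) (x y : Vec d) :
    ‖chainGrad S x - chainGrad S y‖ ≤ 4 * K * ‖x - y‖ := by
  have hpair : Pairwise fun a b : ℕ => inner ℝ (unitVec d (a + 1)) (unitVec d (b + 1)) = 0 :=
    fun a b hab => pairwise_inner_unitVec fun h => hab (Nat.succ_injective h)
  -- Every coordinate occurs in at most two links.
  have hsum : ∑ m ∈ S, ((coord m x - coord m y) ^ 2 + (coord (m + 1) x - coord (m + 1) y) ^ 2) ≤
      2 * ‖x - y‖ ^ 2 := by
    simp only [coord_sub, Finset.sum_add_distrib]
    have := sum_inner_sq_le_norm_sq pairwise_inner_unitVec norm_unitVec_le S (x - y)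
    have := sum_inner_sq_le_norm_sq hpair (fun m => norm_unitVec_le (m + 1)) S (x - y)
    linarith
  have key : ∀ (g : ℝ → ℝ → ℝ) (v : ℕ → Vec d),
      (∀ s t s' t', (g s t - g s' t') ^ 2 ≤ K ^ 2 * ((s - s') ^ 2 + (t - t') ^ 2)) →
      (Pairwise fun a b => inner ℝ (v a) (v b) = 0) → (∀ a, ‖v a‖ ≤ 1) →
      ‖∑ m ∈ S, (g (coord m x) (coord (m + 1) x) - g (coord m y) (coord (m + 1) y)) • v m‖ ≤
        2 * K * ‖x - y‖ := by
    intro g v hg hv hv'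
    refine abs_le_of_sq_le_sq' ?_ (by positivity) |>.2
    refine (norm_sum_smul_sq_le hv hv' _ S).trans
      ((Finset.sum_le_sum fun m _ => hg _ _ _ _).trans ?_)
    rw [← Finset.mul_sum]
    have := mul_le_mul_of_nonneg_left hsum (sq_nonneg K)
    nlinarith [mul_nonneg (sq_nonneg K) (sq_nonneg ‖x - y‖)]
  have hA := key linkFst (unitVec d) h₁ pairwise_inner_unitVec norm_unitVec_le
  have hB := key linkSnd (fun m => unitVec d (m + 1)) h₂ hpair fun m => norm_unitVec_le (m + 1)
  have heq : chainGrad S x - chainGrad S y =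
      ∑ m ∈ S, (linkFst (coord m x) (coord (m + 1) x) -
        linkFst (coord m y) (coord (m + 1) y)) • unitVec d m +
      ∑ m ∈ S, (linkSnd (coord m x) (coord (m + 1) x) -
        linkSnd (coord m y) (coord (m + 1) y)) • unitVec d (m + 1) := by
    rw [chainGrad, chainGrad, ← Finset.sum_sub_distrib, ← Finset.sum_add_distrib]
    refine Finset.sum_congr rfl fun m _ => ?_
    rw [sub_smul, sub_smul]
    abel
  rw [heq]
  refine (norm_add_le _ _).trans ?_
  linarith

theorem chain_zero_le {T : ℕ} : chain (Finset.range T) (0 : Vec d) ≤ T := by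
  have h : ∀ m ∈ Finset.range T, link (coord m (0 : Vec d)) (coord (m + 1) (0 : Vec d)) ≤ 1 := by
    intro m _
    have h₁ : coord (m + 1) (0 : Vec d) = 0 := by simp [coord]
    have h₂ : 0 ≤ Real.arctan (coord m (0 : Vec d)) := by
      rw [← Real.arctan_zero]
      refine Real.arctan_mono ?_
      rw [coord, inner_zero_right, add_zero]
      split_ifs <;> norm_num
    have h₃ : 0 ≤ Real.arctan (coord m (0 : Vec d)) ^ 3 * (0 + Real.pi / 2) := by positivity
    rw [h₁, link, Real.arctan_zero]
    norm_num at h₃ ⊢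
    linarith
  simpa [chain] using Finset.sum_le_card_nsmul _ _ _ h

theorem neg_le_chain {K : ℝ} (hK : ∀ s t, -K ≤ link s t) (T : ℕ) (x : Vec d) :
    -(T * K) ≤ chain (Finset.range T) x := by
  have := Finset.card_nsmul_le_sum (Finset.range T)
    (fun m => link (coord m x) (coord (m + 1) x)) (-K) fun m _ => hK _ _
  rw [Finset.card_range, nsmul_eq_mul, mul_neg] at this
  exact this

/-! ### Rescaling -/

/-- The rescaling `x ↦ a * F (r x)` of `F = chain S`. -/
noncomputable def scaledChain (a r : ℝ) (S : Finset ℕ) (x : Vec d) : ℝ :=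
  a * chain S (r • x)

theorem hasGradientAt_scaledChain (a r : ℝ) (S : Finset ℕ) (x : Vec d) :
    HasGradientAt (scaledChain a r S) ((a * r) • chainGrad S (r • x)) x := by
  rw [hasGradientAt_iff_hasFDerivAt]
  have h := ((hasGradientAt_chain S (r • x)).hasFDerivAt.comp x
    ((hasFDerivAt_id x).const_smul r)).const_mul a
  refine h.congr_fderiv ?_
  ext y
  simp [mul_assoc]

theorem gradient_scaledChain (a r : ℝ) (S : Finset ℕ) (x : Vec d) :
    gradient (scaledChain a r S) x = (a * r) • chainGrad S (r • x) :=
  (hasGradientAt_scaledChain a r S x).gradient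

theorem differentiable_scaledChain (a r : ℝ) (S : Finset ℕ) :
    Differentiable ℝ (scaledChain a r S : Vec d → ℝ) :=
  fun x => (hasGradientAt_scaledChain a r S x).hasFDerivAt.differentiableAt

theorem supp_smul_subset (c : ℝ) (x : Vec d) : supp (c • x) ⊆ supp x := by
  intro i hi h
  apply hi
  rw [PiLp.smul_apply, h, smul_zero]

theorem supp_gradient_scaledChain_subset (a r : ℝ) {S : Finset ℕ} {M : ℕ} (hM : M ∉ S) {x : Vec d}
    (hx : supp x ⊆ {i | (i : ℕ) < M}) :
    supp (gradient (scaledChain a r S) x) ⊆ {i | (i : ℕ) < M} := by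
  rw [gradient_scaledChain]
  exact (supp_smul_subset _ _).trans
    (supp_chainGrad_subset hM ((supp_smul_subset _ _).trans hx))

/-! ### The frontier process -/

variable {n : ℕ}

/-- The event of a round that lets the frontier `N` advance: the multipliers let coordinate `N`
(which has index `N - 1`) pass to the worker that owns the link from `N` to `N + 1`. -/
def Hit (N : ℕ) (h : Fin n → Fin d → ℝ) : Prop :=
  ∃ (i : Fin n) (c : Fin d), (i : ℕ) = N % 2 ∧ (c : ℕ) + 1 = N ∧ h i c ≠ 0

open Classical in
/-- The frontier before round `k`: a bound for the number of leading coordinates that the server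
and the workers may have discovered by then. It depends on the multipliers of the rounds before
`k` only, and not on the algorithm. -/
noncomputable def frontier (h : ℕ → Fin n → Fin d → ℝ) : ℕ → ℕ
  | 0 => 1
  | k + 1 => frontier h k + if Hit (frontier h k) (h k) then 1 else 0

theorem one_le_frontier (h : ℕ → Fin n → Fin d → ℝ) (k : ℕ) : 1 ≤ frontier h k := by
  induction k with
  | zero => exact le_rfl
  | succ k ih => exact ih.trans (Nat.le_add_right _ _)

theorem frontier_le (h : ℕ → Fin n → Fin d → ℝ) (k : ℕ) : frontier h k ≤ k + 1 := by
  induction k with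
  | zero => exact le_rfl
  | succ k ih =>
    rw [frontier]
    split_ifs <;> omega

/-- The number of leading coordinates that worker `i` may know when the frontier is `N`: the owner
of the link from `N` to `N + 1` does not know coordinate `N`. -/
def workerFrontier (N i : ℕ) : ℕ := if N % 2 = i then N - 1 else N

theorem workerFrontier_mod_two {N : ℕ} (hN : 1 ≤ N) (i : ℕ) : workerFrontier N i % 2 ≠ i := by
  unfold workerFrontier
  split_ifs <;> omega

theorem workerFrontier_le (N i : ℕ) : workerFrontier N i ≤ N := by
  unfold workerFrontier
  split_ifs <;> omega

theorem workerFrontier_le_succ (N i : ℕ) : workerFrontier N i ≤ workerFrontier (N + 1) i := by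
  unfold workerFrontier
  split_ifs <;> omega

theorem le_workerFrontier_succ (N i : ℕ) : N ≤ workerFrontier (N + 1) i := by
  unfold workerFrontier
  split_ifs <;> omega

theorem supp_sparsify_subset (h : Fin d → ℝ) (s : Vec d) :
    supp (sparsify h s) ⊆ supp s ∩ {c | h c ≠ 0} := by
  intro c hc
  exact ⟨left_ne_zero_of_mul hc, right_ne_zero_of_mul hc⟩

/-- What the frontier bounds: the messages sent to the server, and the vectors received by the
workers, before round `k`. -/
theorem frontier_spec (A : Algorithm n d) (fs : Fin n → Vec d → ℝ)
    (h : ℕ → Fin n → Fin d → ℝ) (hA : A.RespectsZeros fs h)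
    (hfs : ∀ (i : Fin n) (M : ℕ), M % 2 ≠ i → ∀ x : Vec d, supp x ⊆ {c | (c : ℕ) < M} →
      supp (gradient (fs i) x) ⊆ {c | (c : ℕ) < M}) (k : ℕ) :
    A.knownToServer fs h k ⊆ {c | (c : ℕ) < frontier h k} ∧
    ∀ i : Fin n, ∀ j < k, supp (A.received fs h j i) ⊆
      {c | (c : ℕ) < workerFrontier (frontier h k) i} := by
  induction k with
  | zero =>
    refine ⟨Set.iUnion_subset fun j => j.elim0, fun i j hj => absurd hj (Nat.not_lt_zero j)⟩
  | succ k ih =>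
    obtain ⟨ihS, ihW⟩ := ih
    have hstep : frontier h (k + 1) = frontier h k ∧ ¬ Hit (frontier h k) (h k) ∨
        frontier h (k + 1) = frontier h k + 1 := by
      rw [frontier]
      split_ifs with hit
      · exact Or.inr rfl
      · exact Or.inl ⟨rfl, hit⟩
    have hmono : ∀ i, workerFrontier (frontier h k) i ≤ workerFrontier (frontier h (k + 1)) i := by
      intro i
      rcases hstep with ⟨e, -⟩ | e <;> rw [e]
      exact workerFrontier_le_succ _ _
    have hrec : ∀ i : Fin n, ∀ j < k + 1, supp (A.received fs h j i) ⊆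
        {c | (c : ℕ) < workerFrontier (frontier h (k + 1)) i} := by
      intro i j hj c hc
      rcases Nat.lt_succ_iff_lt_or_eq.1 hj with hj | rfl
      · exact (ihW i j hj hc).trans_le (hmono i)
      · obtain ⟨hcs, hch⟩ := supp_sparsify_subset _ _ hc
        have hcN : (c : ℕ) < frontier h j := ihS (((hA j).2 i).1 hcs)
        rcases hstep with ⟨e, hno⟩ | e
        · rw [Set.mem_ofPred_eq, e, workerFrontier]
          split_ifs with hi
          · -- Without a hit the owner of the next link does not receive the last coordinate.
            have : (c : ℕ) + 1 ≠ frontier h j := fun hc' => hno ⟨i, c, hi.symm, hc', hch⟩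
            omega
          · exact hcN
        · rw [Set.mem_ofPred_eq, e]
          exact hcN.trans_le (le_workerFrontier_succ _ _)
    refine ⟨?_, hrec⟩
    refine Set.iUnion_subset fun j => Set.iUnion_subset fun i => ?_
    rcases Nat.lt_succ_iff_lt_or_eq.1 j.2 with hj | hj
    · intro c hc
      have hck : c ∈ A.knownToServer fs h k :=
        Set.mem_iUnion.2 ⟨⟨j, hj⟩, Set.mem_iUnion.2 ⟨i, hc⟩⟩
      have hle : frontier h k ≤ frontier h (k + 1) := Nat.le_add_right _ _
      exact (ihS hck).trans_le hle
    · obtain ⟨q, hq, hmsg⟩ := ((hA k).2 i).2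
      have hquery : ∀ m, supp (q m) ⊆
          {c | (c : ℕ) < workerFrontier (frontier h (k + 1)) i} := by
        intro m
        induction m using Nat.strong_induction_on with
        | _ m ihm =>
          refine (hq m).trans (Set.union_subset ?_ ?_)
          · exact Set.iUnion_subset fun j => hrec i j j.2
          · exact Set.iUnion_subset fun l => hfs i _
              (workerFrontier_mod_two (one_le_frontier h (k + 1)) i) _ (ihm l l.2)
      rw [hj]
      refine hmsg.trans (Set.iUnion_subset fun m => (hquery m).trans fun c hc => ?_)
      exact lt_of_lt_of_le hc (workerFrontier_le _ _)

/-! ### The speed of the frontier -/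

theorem measurableSet_hit :
    MeasurableSet {z : ℕ × (Fin n → Fin d → ℝ) | Hit z.1 z.2} := by
  have h : {z : ℕ × (Fin n → Fin d → ℝ) | Hit z.1 z.2} = ⋃ (i : Fin n) (c : Fin d),
      (Prod.fst ⁻¹' {N | (i : ℕ) = N % 2 ∧ (c : ℕ) + 1 = N}) ∩
        {z : ℕ × (Fin n → Fin d → ℝ) | z.2 i c ≠ 0} := by
    ext z
    simp [Hit, and_assoc]
  rw [h]
  refine MeasurableSet.iUnion fun i => MeasurableSet.iUnion fun c => ?_
  refine (measurable_fst (MeasurableSet.of_discrete)).inter ?_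
  exact (measurableSet_eq_fun (by fun_prop) measurable_const).compl

/-- The frontier before round `k` is determined by the multipliers of the rounds before `k`. -/
theorem measurable_frontier {Ω : Type*} (η : ℕ → Ω → Fin n → Fin d → ℝ) (k : ℕ) :
    Measurable[⨆ j ∈ Set.Iio k, MeasurableSpace.comap (η j) inferInstance]
      (fun ω => frontier (fun t => η t ω) k) := by
  classical
  induction k with
  | zero => exact measurable_const
  | succ k ih =>
    set m' : MeasurableSpace Ω :=
      ⨆ j ∈ Set.Iio (k + 1), MeasurableSpace.comap (η j) inferInstance with hm'
    have h₁ : Measurable[m'] (fun ω => frontier (fun t => η t ω) k) :=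
      ih.mono (biSup_mono fun j (hj : j < k) => hj.trans (Nat.lt_succ_self k)) le_rfl
    have h₂ : Measurable[m'] (η k) :=
      (comap_measurable (η k)).mono
        (le_biSup (fun j => MeasurableSpace.comap (η j) inferInstance) (Nat.lt_succ_self k)) le_rfl
    have hG : Measurable (fun z : ℕ × (Fin n → Fin d → ℝ) =>
        z.1 + if Hit z.1 z.2 then 1 else 0) :=
      measurable_fst.add (Measurable.ite measurableSet_hit measurable_const measurable_const)
    have := @Measurable.comp _ _ _ m' _ _ _ _ hG (h₁.prodMk h₂)
    exact this

section Probability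

variable {Ω : Type*} [MeasurableSpace Ω] {μ : Measure Ω} [IsProbabilityMeasure μ]
  {η : ℕ → Ω → Fin n → Fin d → ℝ}

theorem measurable_frontier' (hη : ∀ k, Measurable (η k)) (k : ℕ) :
    Measurable (fun ω => frontier (fun t => η t ω) k) :=
  (measurable_frontier η k).mono (iSup₂_le fun j _ => (hη j).comap_le) le_rfl

theorem measureReal_hit_le {p : ℝ} (hp : 0 ≤ p)
    (hηp : ∀ k i j, μ.real {ω | η k ω i j ≠ 0} ≤ p) (k N : ℕ) :
    μ.real {ω | Hit N (η k ω)} ≤ p := by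
  by_cases h : ∃ (i : Fin n) (c : Fin d), (i : ℕ) = N % 2 ∧ (c : ℕ) + 1 = N
  · obtain ⟨i, c, hi, hc⟩ := h
    refine (measureReal_mono ?_).trans (hηp k i c)
    rintro ω ⟨i', c', hi', hc', hne⟩
    have e₁ : i' = i := Fin.ext (hi'.trans hi.symm)
    have e₂ : c' = c := Fin.ext (Nat.succ_injective (hc'.trans hc.symm))
    rwa [e₁, e₂] at hne
  · have : {ω | Hit N (η k ω)} = ∅ := by
      ext ω
      simp only [Set.mem_ofPred_eq, Set.mem_empty_iff_false, iff_false]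
      rintro ⟨i, c, hi, hc, -⟩
      exact h ⟨i, c, hi, hc⟩
    rw [this, measureReal_empty]
    exact hp

/-- The frontier advances in round `k` with probability at most `p`: its position before the round
is independent of the multipliers of the round. -/
theorem measureReal_hit_frontier_le {p : ℝ} (hp : 0 ≤ p) (hη : ∀ k, Measurable (η k))
    (hind : iIndepFun η μ) (hηp : ∀ k i j, μ.real {ω | η k ω i j ≠ 0} ≤ p) (k : ℕ) :
    μ.real {ω | Hit (frontier (fun t => η t ω) k) (η k ω)} ≤ p := by
  set N : Ω → ℕ := fun ω => frontier (fun t => η t ω) k with hN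
  have hNm : Measurable N := measurable_frontier' hη k
  have hIndep := indep_iSup_of_disjoint (fun j => (hη j).comap_le)
    ((iIndepFun_iff_iIndep _ η μ).1 hind)
    (S := Set.Iio k) (T := {k}) (Set.disjoint_singleton_right.2 (lt_irrefl k))
  rw [Indep_iff] at hIndep
  have hprod : ∀ a : ℕ, μ.real ({ω | N ω = a} ∩ {ω | Hit a (η k ω)}) =
      μ.real {ω | N ω = a} * μ.real {ω | Hit a (η k ω)} := by
    intro a
    rw [measureReal_def, measureReal_def, measureReal_def, ← ENNReal.toReal_mul]
    congr 1
    refine hIndep _ _ (measurable_frontier η k (measurableSet_singleton a)) ?_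
    rw [iSup_singleton]
    exact ⟨{h | Hit a h}, measurable_prodMk_left measurableSet_hit, rfl⟩
  have hcover : {ω | Hit (N ω) (η k ω)} ⊆
      ⋃ a ∈ Finset.range (k + 2), {ω | N ω = a} ∩ {ω | Hit a (η k ω)} := by
    intro ω hω
    simp only [Set.mem_iUnion, Finset.mem_range]
    exact ⟨N ω, Nat.lt_succ_of_le (frontier_le _ k), rfl, hω⟩
  have htotal : ∑ a ∈ Finset.range (k + 2), μ.real {ω | N ω = a} ≤ 1 := by
    have := sum_measureReal_preimage_singleton (μ := μ) (f := N) (Finset.range (k + 2))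
      fun a _ => hNm (measurableSet_singleton a)
    exact this.trans_le measureReal_le_one
  calc μ.real {ω | Hit (N ω) (η k ω)}
      ≤ ∑ a ∈ Finset.range (k + 2), μ.real ({ω | N ω = a} ∩ {ω | Hit a (η k ω)}) :=
        (measureReal_mono hcover (measure_ne_top _ _)).trans (measureReal_biUnion_finset_le _ _)
    _ ≤ ∑ a ∈ Finset.range (k + 2), μ.real {ω | N ω = a} * p := by
        refine Finset.sum_le_sum fun a _ => ?_
        rw [hprod]
        exact mul_le_mul_of_nonneg_left (measureReal_hit_le hp hηp k a) measureReal_nonneg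
    _ ≤ p := by
        rw [← Finset.sum_mul]
        exact mul_le_of_le_one_left hp htotal

theorem integrable_frontier (hη : ∀ k, Measurable (η k)) (k : ℕ) :
    Integrable (fun ω => (frontier (fun t => η t ω) k : ℝ)) μ := by
  refine Integrable.of_bound (C := (k : ℝ) + 1)
    (measurable_from_top.comp (measurable_frontier' hη k)).aestronglyMeasurable
    (Filter.Eventually.of_forall fun ω => ?_)
  rw [Real.norm_eq_abs, Nat.abs_cast]
  exact_mod_cast frontier_le _ k

theorem integral_frontier_le {p : ℝ} (hp : 0 ≤ p) (hη : ∀ k, Measurable (η k))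
    (hind : iIndepFun η μ) (hηp : ∀ k i j, μ.real {ω | η k ω i j ≠ 0} ≤ p) (k : ℕ) :
    ∫ ω, (frontier (fun t => η t ω) k : ℝ) ∂μ ≤ 1 + k * p := by
  classical
  induction k with
  | zero => simp [frontier]
  | succ k ih =>
    have hm : MeasurableSet {ω | Hit (frontier (fun t => η t ω) k) (η k ω)} :=
      ((measurable_frontier' hη k).prodMk (hη k)) measurableSet_hit
    have heq : (fun ω => (frontier (fun t => η t ω) (k + 1) : ℝ)) = fun ω =>
        (frontier (fun t => η t ω) k : ℝ) +
        {ω | Hit (frontier (fun t => η t ω) k) (η k ω)}.indicator (fun _ => (1 : ℝ)) ω := by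
      ext ω
      rw [frontier, Set.indicator_apply]
      push_cast
      rfl
    rw [heq, integral_add (integrable_frontier hη k) ((integrable_const 1).indicator hm),
      integral_indicator_const _ hm, smul_eq_mul, mul_one]
    have := measureReal_hit_frontier_le hp hη hind hηp k
    push_cast
    linarith

/-- By Markov's inequality, the frontier is still below `T` with probability at least `1 / 2` if its
expectation is at most `T / 2`. -/
theorem half_le_measureReal_frontier_lt {p : ℝ} (hp : 0 ≤ p) (hη : ∀ k, Measurable (η k))
    (hind : iIndepFun η μ) (hηp : ∀ k i j, μ.real {ω | η k ω i j ≠ 0} ≤ p) {k T : ℕ}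
    (hT : 2 * (1 + k * p) ≤ T) :
    1 / 2 ≤ μ.real {ω | frontier (fun t => η t ω) k < T} := by
  have hTpos : (0 : ℝ) < T := by
    have : 0 ≤ (k : ℝ) * p := by positivity
    linarith
  have h₁ := mul_meas_ge_le_integral_of_nonneg (μ := μ)
    (f := fun ω => (frontier (fun t => η t ω) k : ℝ))
    (Filter.Eventually.of_forall fun ω => Nat.cast_nonneg _) (integrable_frontier hη k) T
  have h₂ := integral_frontier_le hp hη hind hηp k
  have h₃ : {ω | frontier (fun t => η t ω) k < T} =
      {ω | (T : ℝ) ≤ (frontier (fun t => η t ω) k : ℝ)}ᶜ := by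
    ext ω
    simp
  rw [h₃, probReal_compl_eq_one_sub]
  · have : (T : ℝ) * μ.real {ω | (T : ℝ) ≤ (frontier (fun t => η t ω) k : ℝ)} ≤ T * (1 / 2) := by
      linarith
    linarith [le_of_mul_le_mul_left this hTpos]
  · exact measurableSet_le measurable_const
      (measurable_from_top.comp (measurable_frontier' hη k))

end Probability

/-! ### The hard instance -/

/-- The share of worker `i` in the average `scaledChain a r {0, …, T - 1}`: worker `0` owns the
links that start at even coordinates, worker `1` those that start at odd ones, and the functions of
the other workers vanish. -/
noncomputable def workerChain (n : ℕ) (a r : ℝ) (T : ℕ) (i : Fin n) : Vec d → ℝ :=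
  scaledChain (n * a) r ((Finset.range T).filter fun m => m % 2 = i)

/-- Worker `i` discovers nothing as long as it knows at most the first `M` coordinates and does not
own the link that starts at coordinate `M`. -/
theorem supp_gradient_workerChain_subset (a r : ℝ) (T : ℕ) (i : Fin n) {M : ℕ}
    (hM : M % 2 ≠ i) {x : Vec d} (hx : supp x ⊆ {c | (c : ℕ) < M}) :
    supp (gradient (workerChain n a r T i) x) ⊆ {c | (c : ℕ) < M} := by
  rw [workerChain]
  refine supp_gradient_scaledChain_subset _ _ ?_ hx
  rw [Finset.mem_filter]
  exact fun h => hM h.2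

theorem average_workerChain (hn : 2 ≤ n) (a r : ℝ) (T : ℕ) :
    average (workerChain n a r T) = (scaledChain a r (Finset.range T) : Vec d → ℝ) := by
  ext x
  have hn0 : (n : ℝ) ≠ 0 := by
    have : n ≠ 0 := by omega
    exact_mod_cast this
  have hsplit : ∑ i : Fin n, chain ((Finset.range T).filter fun m => m % 2 = i) (r • x) =
      chain (Finset.range T) (r • x) := by
    simp only [chain, Finset.sum_filter]
    rw [Finset.sum_comm]
    refine Finset.sum_congr rfl fun m _ => ?_
    rw [Finset.sum_eq_single ⟨m % 2, by omega⟩]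
    · simp
    · intro i _ hi
      rw [if_neg]
      exact fun h => hi (Fin.ext h.symm)
    · simp
  simp only [average, workerChain, scaledChain, ← Finset.mul_sum, hsplit]
  field_simp

theorem scaledChain_mem_functionClass {K a r L δ : ℝ} {T : ℕ} (hK : 0 ≤ K) (ha : 0 ≤ a)
    (hr : 0 ≤ r) (hlink : ∀ s t, -K ≤ link s t)
    (h₁ : ∀ s t s' t', (linkFst s t - linkFst s' t') ^ 2 ≤ K ^ 2 * ((s - s') ^ 2 + (t - t') ^ 2))
    (h₂ : ∀ s t s' t', (linkSnd s t - linkSnd s' t') ^ 2 ≤ K ^ 2 * ((s - s') ^ 2 + (t - t') ^ 2))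
    (hL : a * r * (4 * K * r) ≤ L) (hδ : a * ((1 + K) * T) ≤ δ) :
    (scaledChain a r (Finset.range T) : Vec d → ℝ) ∈ FunctionClass d δ L := by
  have hlow : ∀ x : Vec d, -(a * (T * K)) ≤ scaledChain a r (Finset.range T) x := by
    intro x
    rw [scaledChain, ← mul_neg]
    exact mul_le_mul_of_nonneg_left (neg_le_chain hlink T _) ha
  refine ⟨differentiable_scaledChain a r _, fun x y => ?_, ⟨-(a * (T * K)), ?_⟩, ?_⟩
  · rw [gradient_scaledChain, gradient_scaledChain, ← smul_sub, norm_smul, Real.norm_eq_abs,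
      abs_of_nonneg (mul_nonneg ha hr)]
    have h := norm_chainGrad_sub_le hK h₁ h₂ (Finset.range T) (r • x) (r • y)
    rw [← smul_sub, norm_smul, Real.norm_eq_abs, abs_of_nonneg hr] at h
    calc a * r * ‖chainGrad (Finset.range T) (r • x) - chainGrad (Finset.range T) (r • y)‖
        ≤ a * r * (4 * K * (r * ‖x - y‖)) := by gcongr
      _ = a * r * (4 * K * r) * ‖x - y‖ := by ring
      _ ≤ L * ‖x - y‖ := by gcongr
  · rintro _ ⟨x, rfl⟩
    exact hlow x
  · have h := le_ciInf hlow
    have h₀ : scaledChain a r (Finset.range T) (0 : Vec d) ≤ a * T := by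
      rw [scaledChain, smul_zero]
      exact mul_le_mul_of_nonneg_left chain_zero_le ha
    linarith

/-! ### The expected squared gradient norm -/

namespace Algorithm

variable {Ω : Type*} [MeasurableSpace Ω] {η : ℕ → Ω → Fin n → Fin d → ℝ}

theorem measurable_workerMessage {A : Algorithm n d} {P : Set (Fin n → Vec d → ℝ)}
    (hA : A.IsBorel P) {fs : Fin n → Vec d → ℝ} (hfs : fs ∈ P) (hη : ∀ k, Measurable (η k))
    (k : ℕ) (i : Fin n) : Measurable fun ω => A.workerMessage fs (fun t => η t ω) k i := by
  induction k using Nat.strong_induction_on generalizing i with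
  | _ k ih =>
    simp only [workerMessage_eq]
    refine (hA.2.2 fs hfs k i).comp (measurable_pi_lambda _ fun j => ?_)
    have hs : Measurable fun ω => A.serverMessage fs (fun t => η t ω) j i :=
      (hA.2.1 j i).comp (measurable_pi_lambda _ fun l => measurable_pi_lambda _ fun i' =>
        ih l (by omega) i')
    refine (WithLp.measurable_toLp 2 _).comp (measurable_pi_lambda _ fun c => ?_)
    have hc : Measurable fun ω => A.serverMessage fs (fun t => η t ω) j i c :=
      (EuclideanSpace.proj (𝕜 := ℝ) c).continuous.measurable.comp hs
    exact hc.mul ((measurable_pi_apply c).comp ((measurable_pi_apply i).comp (hη j)))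

theorem measurable_iterate {A : Algorithm n d} {P : Set (Fin n → Vec d → ℝ)}
    (hA : A.IsBorel P) {fs : Fin n → Vec d → ℝ} (hfs : fs ∈ P) (hη : ∀ k, Measurable (η k))
    (k : ℕ) : Measurable fun ω => A.iterate fs (fun t => η t ω) k :=
  (hA.1 k).comp (measurable_pi_lambda _ fun l => measurable_pi_lambda _ fun i =>
    measurable_workerMessage hA hfs hη l i)

end Algorithm

theorem le_norm_gradient_iterate {A : Algorithm n d} {a r : ℝ} {T : ℕ} (ha : 0 ≤ a) (hr : 0 ≤ r)
    (hTd : T ≤ d) {h : ℕ → Fin n → Fin d → ℝ} (hA : A.RespectsZeros (workerChain n a r T) h)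
    {k : ℕ} (hk : frontier h k < T) :
    a * r * (1 / 20) ≤
      ‖gradient (scaledChain a r (Finset.range T)) (A.iterate (workerChain n a r T) h k)‖ := by
  have hspec := (frontier_spec A (workerChain n a r T) h hA (fun i M hM x hx =>
    supp_gradient_workerChain_subset a r T i hM hx) k).1
  have hsupp := (hA k).1.trans hspec
  rw [gradient_scaledChain, norm_smul, Real.norm_eq_abs, abs_of_nonneg (mul_nonneg ha hr)]
  refine mul_le_mul_of_nonneg_left (one_div_twenty_le_norm_chainGrad hTd ?_) (mul_nonneg ha hr)
  refine ⟨⟨T - 1, by omega⟩, show T - 1 < T by omega, ?_⟩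
  have : A.iterate (workerChain n a r T) h k ⟨T - 1, by omega⟩ = 0 := by
    by_contra hne
    have hlt : T - 1 < frontier h k := hsupp hne
    omega
  rw [PiLp.smul_apply, this, smul_zero]
  exact one_pos

/-- A bounded measurable function that is at least `c` with probability at least `1 / 2` has
expectation at least `c / 2`. -/
theorem half_le_integral {Ω : Type*} [MeasurableSpace Ω] {μ : Measure Ω} [IsProbabilityMeasure μ]
    {X : Ω → ℝ} {c C : ℝ} {s : Set Ω} (hc : 0 ≤ c) (hX : Measurable X) (hX₀ : ∀ ω, 0 ≤ X ω)
    (hC : ∀ ω, X ω ≤ C) (hs : 1 / 2 ≤ μ.real s) (hsX : ∀ ω ∈ s, c ≤ X ω) :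
    c / 2 ≤ ∫ ω, X ω ∂μ := by
  have hint : Integrable X μ := Integrable.of_bound (C := C) hX.aestronglyMeasurable
    (Filter.Eventually.of_forall fun ω => by
      rw [Real.norm_eq_abs, abs_of_nonneg (hX₀ ω)]
      exact hC ω)
  have h₁ := mul_meas_ge_le_integral_of_nonneg (Filter.Eventually.of_forall hX₀) hint c
  have h₂ : μ.real s ≤ μ.real {ω | c ≤ X ω} := measureReal_mono hsX
  have h₃ := mul_le_mul_of_nonneg_left (hs.trans h₂) hc
  linarith

end LowerBound


theorem mainTheorem5 :
    ∃ cbar chat : ℝ, 0 < cbar ∧ 0 < chat ∧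
      ∀ L δ ε : ℝ, 0 < L → 0 < δ → 0 < ε → cbar * ε < L * δ →
        ∃ d₀ : ℕ, ∀ d : ℕ, d₀ ≤ d →
          ∀ (n : ℕ) (p : ℝ), 2 ≤ n → 0 < p →
          ∀ (Ω : Type*) [MeasurableSpace Ω] (μ : Measure Ω) [IsProbabilityMeasure μ]
            (η : ℕ → Ω → Fin n → Fin d → ℝ),
            (∀ k, Measurable (η k)) →
            iIndepFun η μ →
            (∀ k i j, μ.real {ω | η k ω i j ≠ 0} ≤ p) →
            ∀ A : LowerBound.Algorithm n d,
              A.IsZeroRespecting (LowerBound.ProblemClass n d δ L) η →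
              ∃ f ∈ LowerBound.FunctionClass d δ L,
                ∃ fs : Fin n → LowerBound.Vec d → ℝ,
                  (∀ i, Differentiable ℝ (fs i)) ∧
                  f = LowerBound.average fs ∧
                  ∀ k : ℕ, (k : ℝ) ≤ chat * (L * δ / (p * ε)) →
                    ε < ∫ ω, ‖gradient f (A.iterate fs (fun t => η t ω) k)‖ ^ 2 ∂μ := by
  obtain ⟨K, hK, hlink, hb₁, hb₂, hl₁, hl₂⟩ := LowerBound.exists_link_bounds
  -- The potential drop of a link, after rescaling, is at most `M * ε / L`.
  obtain ⟨M, hM⟩ : ∃ M : ℝ, M = 6400 * K * (1 + K) := ⟨_, rfl⟩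
  have hM0 : 0 < M := by rw [hM]; positivity
  refine ⟨4 * M, 1 / (8 * M), by positivity, by positivity, fun L δ ε hL hδ hε hcond => ?_⟩
  -- The chain is as long as the budget `δ` allows.
  set R : ℝ := L * δ / (M * ε) with hR
  have hR4 : 4 < R := by
    rw [hR, lt_div_iff₀ (by positivity)]
    linarith
  set T : ℕ := ⌊R⌋₊ with hT
  have hTR : (T : ℝ) ≤ R := Nat.floor_le (by linarith)
  have hRT : R < T + 1 := Nat.lt_floor_add_one R
  refine ⟨T, fun d hTd n p hn hp Ω _ μ _ η hη hind hηp A hA => ?_⟩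
  -- The factors make the gradient `L`-Lipschitz, and at least `2 * √ε` until the end of the chain.
  have hsε : 0 < √ε := Real.sqrt_pos.2 hε
  have hsq : √ε * √ε = ε := Real.mul_self_sqrt hε.le
  set r : ℝ := L / (160 * K * √ε) with hr
  set a : ℝ := 6400 * K * ε / L with ha
  have hr0 : 0 < r := by positivity
  have ha0 : 0 < a := by positivity
  have har : a * r = 40 * √ε := by
    rw [ha, hr]
    field_simp
    rw [sq, hsq]
    ring
  have hmem : (LowerBound.scaledChain a r (Finset.range T) : LowerBound.Vec d → ℝ) ∈
      LowerBound.FunctionClass d δ L := by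
    refine LowerBound.scaledChain_mem_functionClass hK.le ha0.le hr0.le hlink hl₁ hl₂ ?_ ?_
    · rw [har, hr]
      apply le_of_eq
      field_simp
      norm_num
    · have : a * ((1 + K) * T) ≤ a * ((1 + K) * R) := by gcongr
      refine this.trans (le_of_eq ?_)
      rw [ha, hR, hM]
      field_simp
  have havg := LowerBound.average_workerChain (d := d) hn a r T
  have hdiff : ∀ i, Differentiable ℝ (LowerBound.workerChain n a r T i : LowerBound.Vec d → ℝ) :=
    fun i => LowerBound.differentiable_scaledChain _ _ _
  have hfs : (LowerBound.workerChain n a r T : Fin n → LowerBound.Vec d → ℝ) ∈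
      LowerBound.ProblemClass n d δ L := ⟨hdiff, havg ▸ hmem⟩
  refine ⟨_, hmem, LowerBound.workerChain n a r T, hdiff, havg.symm, fun k hk => ?_⟩
  have hkT : 2 * (1 + (k : ℝ) * p) ≤ T := by
    have h₁ : (k : ℝ) * p ≤ 1 / (8 * M) * (L * δ / (p * ε)) * p := by gcongr
    have h₂ : 1 / (8 * M) * (L * δ / (p * ε)) * p = R / 8 := by
      rw [hR]
      field_simp
    linarith
  have hprob := LowerBound.half_le_measureReal_frontier_lt hp.le hη hind hηp hkT
  have hmeas : Measurable fun ω => ‖gradient (LowerBound.scaledChain a r (Finset.range T))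
      (A.iterate (LowerBound.workerChain n a r T) (fun t => η t ω) k)‖ ^ 2 := by
    have hcont : Continuous (gradient
        (LowerBound.scaledChain a r (Finset.range T) : LowerBound.Vec d → ℝ)) :=
      (LipschitzWith.of_dist_le_mul (K := ⟨L, hL.le⟩) fun x y => by
        rw [dist_eq_norm, dist_eq_norm]
        exact hmem.2.1 x y).continuous
    exact ((hcont.norm.pow 2).measurable).comp
      (LowerBound.Algorithm.measurable_iterate hA.1 hfs hη k)
  have hbound : ∀ x : LowerBound.Vec d,
      ‖gradient (LowerBound.scaledChain a r (Finset.range T)) x‖ ^ 2 ≤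
        (a * r * (T * (2 * K))) ^ 2 := by
    intro x
    rw [LowerBound.gradient_scaledChain, norm_smul, Real.norm_eq_abs, abs_of_pos (by positivity)]
    have := LowerBound.norm_chainGrad_le hb₁ hb₂ (Finset.range T) (r • x)
    rw [Finset.card_range] at this
    gcongr
  have hmain := LowerBound.half_le_integral (c := 4 * ε) (by positivity) hmeas
    (fun ω => by positivity) (fun ω => hbound _) hprob fun ω hω => by
      have h := LowerBound.le_norm_gradient_iterate ha0.le hr0.le hTd (hA.2 _ hfs ω) hω
      have h₂ := pow_le_pow_left₀ (by positivity) h 2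
      refine le_trans (le_of_eq ?_) h₂
      rw [har, mul_pow, mul_pow, sq √ε, hsq]
      ring
  linarith
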